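/- For a bounded set $E\subset\mathbb{R}^n$ let $N_E(\epsilon)$ be the smallest positive integer $N$ such that $E$ can be covered by $N$ axis-parallel boxes of side-length at most $\epsilon$. Let $\dim_M E=\limsup_{\epsilon\to0^+}\log N_E(\epsilon)/\log(1/\epsilon)$ be the (upper) Minkowski dimension of $E$ (with $\dim_M E=\infty$ if $E$ is unbounded), and for arbitrary $E\subset\mathbb{R}^n$ let $\dim_P E=\inf\{\sup_{j\in\mathbb{N}}\dim_M E_j : E\subset\bigcup_{j\in\mathbb{N}}E_j\}$ be its packing dimension. For $S\subset\mathbb{R}^2$ let $\mathcal{h}^M(S)$ and $\mathcal{h}^P(S)$ be the infimum of $\dim_M B$, respectively of $\dim_P B$, over all sets $B\subset\mathbb{R}^2$ such that for each $x\in S$ there is an $r>0$ for which $B$ contains the boundary of the axis-parallel square with centre $x$ and side-length $2r$. (1) There is a number $h\in[17/11,\,7/4]$ such that $\mathcal{h}^M(S)=\mathcal{h}^P(S)=h$ for every segment $S=[a,b]\times\{0\}$, $a<b$, of the $x$-axis. (2) $\mathcal{h}^M(S)=\mathcal{h}^P(S)=3/2$ for every segment $S=\{(t,t): a\le t\le b\}$,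 $a<b$, of the line $y=x$. -/

import Mathlib

open Set Filter Topology

noncomputable section

/-- `N_E(ε)`: the smallest positive integer `k` such that `E ⊆ ℝⁿ` can be covered by `k`
axis-parallel boxes of side-length at most `ε` (`⊤` if there is no such `k`). -/
def boxCoveringNumber {n : ℕ} (E : Set (Fin n → ℝ)) (ε : ℝ) : ℕ∞ :=
  ⨅ (k : ℕ) (_ : 0 < k ∧ ∃ l u : Fin k → Fin n → ℝ,
    (∀ j i, u j i - l j i ≤ ε) ∧ E ⊆ ⋃ j, Icc (l j) (u j)), (k : ℕ∞)

/-- The (upper) Minkowski dimension, i.e. the upper box dimension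
`limsup_{ε → 0+} log N_E(ε) / log (1/ε)`; it is `⊤` when `E` is unbounded. -/
def minkowskiDim {n : ℕ} (E : Set (Fin n → ℝ)) : EReal :=
  limsup (fun ε : ℝ =>
    ENNReal.log (boxCoveringNumber E ε : ENNReal) / ((Real.log (1 / ε) : ℝ) : EReal)) (𝓝[>] 0)

/-- The packing dimension, i.e. the modified upper box dimension
`inf { sup_j dim_M (F j) : E ⊆ ⋃ j, F j }`. -/
def packingDim {n : ℕ} (E : Set (Fin n → ℝ)) : EReal :=
  ⨅ (F : ℕ → Set (Fin n → ℝ)) (_ : E ⊆ ⋃ j, F j), ⨆ j, minkowskiDim (F j)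

/-- The boundary of the square `[-1, 1]²`. -/
def unitSquare : Set (Fin 2 → ℝ) := {p | max |p 0| |p 1| = 1}

/-- `B` contains (the boundary of) a nondegenerate axis-parallel square centred at each point
of `S`. -/
def ContainsSquares (S B : Set (Fin 2 → ℝ)) : Prop :=
  ∀ x ∈ S, ∃ r : ℝ, 0 < r ∧ ∀ p ∈ unitSquare, x + r • p ∈ B

/-- The minimal Minkowski dimension of a set containing an axis-parallel square centred at each
point of `S`. -/
def minMinkowskiDim (S : Set (Fin 2 → ℝ)) : EReal :=
  ⨅ (B : Set (Fin 2 → ℝ)) (_ : ContainsSquares S B), minkowskiDim B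

/-- The minimal packing dimension of a set containing an axis-parallel square centred at each
point of `S`. -/
def minPackingDim (S : Set (Fin 2 → ℝ)) : EReal :=
  ⨅ (B : Set (Fin 2 → ℝ)) (_ : ContainsSquares S B), packingDim B

end

/-!
A square centred at `(x, c x)` has vertical sides with abscissae `x ± r` and horizontal sides with
ordinates `c x ± r`. Conversely, if these numbers lie in sets `X`, `Y ⊆ ℝ` of box dimension `t` for
all `x` in an interval, then `X × J ∪ J × Y` has dimension `t + 1` for a bounded interval `J`. Any
set that contains the squares yields such `X` and `Y` with `t` one less than its dimension; for
packing dimension one first passes to closed sets and uses the Baire category theorem, at the cost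
of shrinking the segment, which affine rescaling undoes. Hence the Minkowski and packing minima
agree and do not depend on the segment.

From `x = ((x - r) + (x + r)) / 2` one gets `1 ≤ 2 t`. When `c = 0` the differences `2 r` of the
pairs `(x + r, x - r) ∈ X × X` are confined to `2 Y` while the sums `2 x` fill an interval, so the
Katz–Tao sums-differences inequality gives `6 ≤ 11 t`. In the other direction, `X` and `Y` are
built from the numbers whose binary expansions are supported on one residue class of places: modulo
`2` on the diagonal, with `t = 1 / 2`, and modulo `3` on the horizontal axis, with `t = 2 / 3`.
-/

section KatzTao

variable {ι α β γ M : Type*}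

theorem card_fiber_pos [DecidableEq α] {s : Finset ι} (f : ι → α) {x : ι} (hx : x ∈ s) :
    0 < (s.filter fun y => f y = f x).card :=
  Finset.card_pos.2 ⟨x, Finset.mem_filter.2 ⟨hx, rfl⟩⟩

theorem sum_inv_card_fiber [DecidableEq α] (s : Finset ι) (f : ι → α) :
    ∑ x ∈ s, ((s.filter fun y => f y = f x).card : ℝ)⁻¹ = (s.image f).card := by
  rw [← Finset.sum_fiberwise_of_maps_to fun x => Finset.mem_image_of_mem f,
    Finset.card_eq_sum_ones, Nat.cast_sum]
  refine Finset.sum_congr rfl fun b hb => ?_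
  have hconst : ∀ x ∈ s.filter fun x => f x = b,
      ((s.filter fun y => f y = f x).card : ℝ)⁻¹ = ((s.filter fun y => f y = b).card : ℝ)⁻¹ := by
    intro x hx
    rw [(Finset.mem_filter.1 hx).2]
  have hne : (s.filter fun y => f y = b).card ≠ 0 :=
    Finset.card_ne_zero.2 (Finset.fiber_nonempty_iff_mem_image.2 hb)
  rw [Finset.sum_congr rfl hconst, Finset.sum_const, nsmul_eq_mul,
    mul_inv_cancel₀ (Nat.cast_ne_zero.2 hne), Nat.cast_one]

theorem card_sq_le_card_image_mul_card_collisions [DecidableEq α] (s : Finset ι) (f : ι → α) :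
    s.card ^ 2 ≤ (s.image f).card * ((s ×ˢ s).filter fun p => f p.1 = f p.2).card := by
  have hcollisions : ((s ×ˢ s).filter fun p => f p.1 = f p.2).card =
      ∑ b ∈ s.image f, (s.filter fun x => f x = b).card ^ 2 := by
    rw [Finset.card_eq_sum_card_fiberwise (f := fun p : ι × ι => f p.1) (t := s.image f)]
    · refine Finset.sum_congr rfl fun b _ => ?_
      rw [sq, ← Finset.card_product]
      congr 1
      ext p
      simp only [Finset.mem_filter, Finset.mem_product]
      grind
    · intro p hp
      exact Finset.mem_image_of_mem f (Finset.mem_product.1 (Finset.mem_filter.1 hp).1).1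
  rw [hcollisions, Finset.card_eq_sum_card_image f s]
  exact sq_sum_le_card_mul_sum_sq

/-- The quadruples `((x₁, x₂), (x₃, x₄))` of elements of `s` in which `x₁, x₂` collide under `f`,
`x₂, x₃` under `g`, and `x₃, x₄` under `h`. There are many of them when the images of `s` are
small. -/
def collisionChains [DecidableEq α] [DecidableEq β] [DecidableEq γ] (s : Finset ι)
    (f : ι → α) (g : ι → β) (h : ι → γ) : Finset ((ι × ι) × (ι × ι)) :=
  ((s ×ˢ s) ×ˢ (s ×ˢ s)).filter fun q =>
    f q.1.1 = f q.1.2 ∧ g q.1.2 = g q.2.1 ∧ h q.2.1 = h q.2.2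

theorem mem_collisionChains [DecidableEq α] [DecidableEq β] [DecidableEq γ] {s : Finset ι}
    {f : ι → α} {g : ι → β} {h : ι → γ} {x₁ x₂ x₃ x₄ : ι} :
    ((x₁, x₂), (x₃, x₄)) ∈ collisionChains s f g h ↔
      ((x₁ ∈ s ∧ x₂ ∈ s) ∧ x₃ ∈ s ∧ x₄ ∈ s) ∧ f x₁ = f x₂ ∧ g x₂ = g x₃ ∧ h x₃ = h x₄ := by
  simp only [collisionChains, Finset.mem_filter, Finset.mem_product]

theorem sum_card_fiber_eq_card_collisions [DecidableEq α] (s t : Finset ι) (f : ι → α) :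
    ∑ x ∈ t, (s.filter fun y => f y = f x).card =
      ((s ×ˢ t).filter fun p => f p.1 = f p.2).card := by
  simp only [Finset.card_filter, Finset.sum_product_right]

theorem card_collisionChains [DecidableEq α] [DecidableEq β] [DecidableEq γ] (s : Finset ι)
    (f : ι → α) (g : ι → β) (h : ι → γ) :
    (collisionChains s f g h).card =
      ∑ b ∈ s.image g, (∑ x ∈ s with g x = b, (s.filter fun y => f y = f x).card) *
        ∑ x ∈ s with g x = b, (s.filter fun y => h y = h x).card := by
  rw [Finset.card_eq_sum_card_fiberwise (f := fun q => g q.1.2) (t := s.image g)]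
  · refine Finset.sum_congr rfl fun b _ => ?_
    rw [sum_card_fiber_eq_card_collisions, sum_card_fiber_eq_card_collisions,
      ← Finset.card_product]
    refine Finset.card_bij' (fun q _ => (q.1, q.2.swap)) (fun q _ => (q.1, q.2.swap))
      ?_ ?_ ?_ ?_ <;> grind [collisionChains]
  · rintro ⟨⟨x₁, x₂⟩, x₃, x₄⟩ hq
    exact Finset.mem_image_of_mem g (mem_collisionChains.1 hq).1.1.2

theorem card_pow_four_le_card_image_mul_sums [DecidableEq β] (s : Finset ι) (g : ι → β)
    {d e : ι → ℝ} (hd : ∀ x ∈ s, 0 < d x) (he : ∀ x ∈ s, 0 < e x) :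
    (s.card : ℝ) ^ 4 ≤ (s.image g).card *
      (∑ b ∈ s.image g, (∑ x ∈ s with g x = b, d x) * ∑ x ∈ s with g x = b, e x) *
      ((∑ x ∈ s, (d x)⁻¹) * ∑ x ∈ s, (e x)⁻¹) := by
  set w : ι → ℝ := fun x => √(d x * e x)
  have hw (x) (hx : x ∈ s) : 0 < w x := Real.sqrt_pos.2 (mul_pos (hd x hx) (he x hx))
  have hwsq (x) (hx : x ∈ s) : w x ^ 2 = d x * e x :=
    Real.sq_sqrt (mul_pos (hd x hx) (he x hx)).le
  have hcard : (s.card : ℝ) ^ 2 ≤ (∑ x ∈ s, w x) * ∑ x ∈ s, (w x)⁻¹ := by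
    have hone : ∑ _x ∈ s, (1 : ℝ) = s.card := by rw [Finset.sum_const, nsmul_one]
    rw [← hone]
    exact Finset.sum_sq_le_sum_mul_sum_of_sq_le_mul s (fun x hx => (hw x hx).le)
      (fun x hx => (inv_pos.2 (hw x hx)).le)
      fun x hx => by rw [mul_inv_cancel₀ (hw x hx).ne', one_pow]
  have hinv : (∑ x ∈ s, (w x)⁻¹) ^ 2 ≤ (∑ x ∈ s, (d x)⁻¹) * ∑ x ∈ s, (e x)⁻¹ :=
    Finset.sum_sq_le_sum_mul_sum_of_sq_le_mul s (fun x hx => (inv_pos.2 (hd x hx)).le)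
      (fun x hx => (inv_pos.2 (he x hx)).le) fun x hx => by rw [inv_pow, hwsq x hx, mul_inv]
  have hfiber (b : β) : (∑ x ∈ s with g x = b, w x) ^ 2 ≤
      (∑ x ∈ s with g x = b, d x) * ∑ x ∈ s with g x = b, e x :=
    Finset.sum_sq_le_sum_mul_sum_of_sq_le_mul _
      (fun x hx => (hd x (Finset.mem_of_mem_filter x hx)).le)
      (fun x hx => (he x (Finset.mem_of_mem_filter x hx)).le)
      fun x hx => (hwsq x (Finset.mem_of_mem_filter x hx)).le
  have hsum : (∑ x ∈ s, w x) ^ 2 ≤ (s.image g).card *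
      ∑ b ∈ s.image g, (∑ x ∈ s with g x = b, d x) * ∑ x ∈ s with g x = b, e x := by
    rw [← Finset.sum_fiberwise_of_maps_to fun x => Finset.mem_image_of_mem g]
    exact sq_sum_le_card_mul_sum_sq.trans
      (mul_le_mul_of_nonneg_left (Finset.sum_le_sum fun b _ => hfiber b) (Nat.cast_nonneg _))
  calc (s.card : ℝ) ^ 4 = ((s.card : ℝ) ^ 2) ^ 2 := by ring
    _ ≤ ((∑ x ∈ s, w x) * ∑ x ∈ s, (w x)⁻¹) ^ 2 := by gcongr
    _ = (∑ x ∈ s, w x) ^ 2 * (∑ x ∈ s, (w x)⁻¹) ^ 2 := mul_pow _ _ _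
    _ ≤ _ := mul_le_mul hsum hinv (sq_nonneg _) ((sq_nonneg _).trans hsum)

theorem card_pow_four_le_card_images_mul_card_collisionChains [DecidableEq α] [DecidableEq β]
    [DecidableEq γ] (s : Finset ι) (f : ι → α) (g : ι → β) (h : ι → γ) :
    s.card ^ 4 ≤ (s.image f).card * (s.image g).card * (s.image h).card *
      (collisionChains s f g h).card := by
  have hweighted := card_pow_four_le_card_image_mul_sums s g
    (fun x hx => Nat.cast_pos.2 (card_fiber_pos f hx))
    (fun x hx => Nat.cast_pos.2 (card_fiber_pos h hx))
  rw [sum_inv_card_fiber, sum_inv_card_fiber] at hweighted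
  have hchains : (s.card : ℝ) ^ 4 ≤
      (s.image g).card * (collisionChains s f g h).card *
        ((s.image f).card * (s.image h).card) := by
    simpa only [card_collisionChains, Nat.cast_sum, Nat.cast_mul] using hweighted
  calc s.card ^ 4 ≤ (s.image g).card * (collisionChains s f g h).card *
        ((s.image f).card * (s.image h).card) := by exact_mod_cast hchains
    _ = _ := by ring

/-- The pairs of points of `G` with the same first coordinate. The Katz–Tao argument counts chains
of collisions between such pairs. -/
def verticalPairs [DecidableEq M] (G : Finset (M × M)) : Finset ((M × M) × (M × M)) :=
  (G ×ˢ G).filter fun v => v.1.1 = v.2.1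

theorem mem_verticalPairs [DecidableEq M] {G : Finset (M × M)} {v : (M × M) × (M × M)} :
    v ∈ verticalPairs G ↔ v.1 ∈ G ∧ v.2 ∈ G ∧ v.1.1 = v.2.1 := by
  simp only [verticalPairs, Finset.mem_filter, Finset.mem_product, and_assoc]

theorem card_verticalPairs_chains_le [AddCommGroup M] [DecidableEq M] {G : Finset (M × M)}
    (hinj : InjOn (fun g => g.1 + g.2) (G : Set (M × M))) :
    (collisionChains (verticalPairs G) (fun v => (v.1.1 - v.1.2, v.2.1 - v.2.2))
        (fun v => (v.1.2, v.2.2)) (fun v => (v.1.1 - v.1.2, v.2.2))).card ≤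
      (verticalPairs G).card * ((G.image Prod.fst).card * (G.image Prod.snd).card) := by
  rw [← Finset.card_product, ← Finset.card_product]
  refine Finset.card_le_card_of_injOn (fun q => (q.1.1, q.2.1.1.1, q.2.2.1.2)) ?_ ?_
  · rintro ⟨⟨v₁, v₂⟩, v₃, v₄⟩ hv
    obtain ⟨⟨⟨h₁, -⟩, h₃, h₄⟩, -⟩ := mem_collisionChains.1 hv
    exact Finset.mk_mem_product h₁ (Finset.mk_mem_product
      (Finset.mem_image_of_mem Prod.fst (mem_verticalPairs.1 h₃).1)
      (Finset.mem_image_of_mem Prod.snd (mem_verticalPairs.1 h₄).1))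
  · rintro ⟨⟨⟨⟨a₁, b₁⟩, a₁', b₁'⟩, ⟨a₂, b₂⟩, a₂', b₂'⟩,
      ⟨⟨a₃, b₃⟩, a₃', b₃'⟩, ⟨a₄, b₄⟩, a₄', b₄'⟩ hv
      ⟨⟨⟨⟨c₁, d₁⟩, c₁', d₁'⟩, ⟨c₂, d₂⟩, c₂', d₂'⟩,
      ⟨⟨c₃, d₃⟩, c₃', d₃'⟩, ⟨c₄, d₄⟩, c₄', d₄'⟩ hw heq
    simp only [Finset.mem_coe, mem_collisionChains, mem_verticalPairs, Prod.mk.injEq] at hv hw heq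
    -- `a₄' + b₄' = a₃ + b₄ + (b₁' - b₁)` is determined by the image of the chain.
    have hlast : (a₄', b₄') = (c₄', d₄') :=
      hinj hv.1.2.2.2.1 hw.1.2.2.2.1 (by grind)
    simp only [Prod.mk.injEq] at hlast ⊢
    grind

theorem card_verticalPairs_pow_three_le [AddCommGroup M] [DecidableEq M] {G : Finset (M × M)}
    (hinj : InjOn (fun g => g.1 + g.2) (G : Set (M × M))) :
    (verticalPairs G).card ^ 3 ≤ (G.image Prod.fst).card * (G.image Prod.snd).card ^ 4 *
      (G.image fun g => g.1 - g.2).card ^ 3 := by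
  set A := G.image Prod.fst
  set B := G.image Prod.snd
  set C := G.image fun g => g.1 - g.2
  set V := verticalPairs G
  have hB {g} (hg : g ∈ G) : g.2 ∈ B := Finset.mem_image_of_mem _ hg
  have hC {g} (hg : g ∈ G) : g.1 - g.2 ∈ C := Finset.mem_image_of_mem (fun g => g.1 - g.2) hg
  have card_image_le {S T : Finset M} {k : (M × M) × (M × M) → M × M}
      (hk : ∀ v, v.1 ∈ G → v.2 ∈ G → k v ∈ S ×ˢ T) : (V.image k).card ≤ S.card * T.card := by
    rw [← Finset.card_product]
    exact Finset.card_le_card (Finset.image_subset_iff.2 fun v hv =>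
      hk v (mem_verticalPairs.1 hv).1 (mem_verticalPairs.1 hv).2.1)
  rcases Nat.eq_zero_or_pos V.card with hV | hV
  · simp [hV]
  refine Nat.le_of_mul_le_mul_left ?_ hV
  calc V.card * V.card ^ 3 = V.card ^ 4 := by ring
    _ ≤ C.card * C.card * (B.card * B.card) * (C.card * B.card) *
        (V.card * (A.card * B.card)) := by
      refine (card_pow_four_le_card_images_mul_card_collisionChains (α := M × M) (β := M × M)
        (γ := M × M) V _ _ _).trans (Nat.mul_le_mul ?_ (card_verticalPairs_chains_le hinj))
      exact Nat.mul_le_mul (Nat.mul_le_mul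
        (card_image_le fun v h h' => Finset.mk_mem_product (hC h) (hC h'))
        (card_image_le fun v h h' => Finset.mk_mem_product (hB h) (hB h')))
        (card_image_le fun v h h' => Finset.mk_mem_product (hC h) (hB h'))
    _ = V.card * (A.card * B.card ^ 4 * C.card ^ 3) := by ring

theorem card_pow_six_le_of_injOn_add [AddCommGroup M] [DecidableEq M] {G : Finset (M × M)}
    (hinj : InjOn (fun g => g.1 + g.2) (G : Set (M × M))) :
    G.card ^ 6 ≤ (G.image Prod.fst).card ^ 4 * (G.image Prod.snd).card ^ 4 *
      (G.image fun g => g.1 - g.2).card ^ 3 := by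
  have hpairs : G.card ^ 2 ≤ (G.image Prod.fst).card * (verticalPairs G).card :=
    card_sq_le_card_image_mul_card_collisions G Prod.fst
  calc G.card ^ 6 = (G.card ^ 2) ^ 3 := by ring
    _ ≤ ((G.image Prod.fst).card * (verticalPairs G).card) ^ 3 := by gcongr
    _ = (G.image Prod.fst).card ^ 3 * (verticalPairs G).card ^ 3 := mul_pow _ _ _
    _ ≤ _ := Nat.mul_le_mul_left _ (card_verticalPairs_pow_three_le hinj)
    _ = _ := by ring

end KatzTao

section CoveringExponent

variable {X Y : Type*}

theorem tendsto_div_nhdsGT_zero {K : ℝ} (hK : 0 < K) :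
    Tendsto (fun δ : ℝ => δ / K) (𝓝[>] 0) (𝓝[>] 0) := by
  refine tendsto_nhdsWithin_iff.2 ⟨?_, ?_⟩
  · exact Tendsto.mono_left (Continuous.tendsto' (by fun_prop) _ _ (zero_div K))
      nhdsWithin_le_nhds
  · filter_upwards [self_mem_nhdsWithin] with δ hδ using div_pos hδ hK

theorem div_rpow_neg {δ K : ℝ} (hδ : 0 ≤ δ) (hK : 0 ≤ K) (t : ℝ) :
    (δ / K) ^ (-t) = K ^ t * δ ^ (-t) := by
  rw [Real.div_rpow hδ hK, Real.rpow_neg hK, div_inv_eq_mul, mul_comm]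

theorem eventually_mul_rpow_neg_le {α β : ℝ} (hαβ : α < β) (C : ℝ) :
    ∀ᶠ δ in 𝓝[>] (0 : ℝ), C * δ ^ (-α) ≤ δ ^ (-β) := by
  have hpos : 0 < β - α := sub_pos.2 hαβ
  have hlim : Tendsto (fun δ : ℝ => C * δ ^ (β - α)) (𝓝[>] 0) (𝓝 0) := by
    have hcont := (Real.continuousAt_rpow_const 0 (β - α) (Or.inr hpos.le)).tendsto
    rw [Real.zero_rpow hpos.ne'] at hcont
    simpa only [mul_zero] using (hcont.const_mul C).mono_left nhdsWithin_le_nhds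
  filter_upwards [hlim.eventually_le_const one_pos, self_mem_nhdsWithin] with δ hδ (h0 : 0 < δ)
  calc C * δ ^ (-α) = C * δ ^ (β - α) * δ ^ (-β) := by
        rw [mul_assoc, ← Real.rpow_add h0]
        congr 2
        ring
    _ ≤ δ ^ (-β) := mul_le_of_le_one_left (Real.rpow_nonneg h0.le _) hδ

theorem exponent_le_of_eventually_le {κ C α β : ℝ} (hκ : 0 < κ)
    (h : ∀ᶠ δ in 𝓝[>] (0 : ℝ), κ * δ ^ (-α) ≤ C * δ ^ (-β)) : α ≤ β := by
  by_contra! hlt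
  obtain ⟨δ, hδ, hlarge, h0⟩ := (h.and ((eventually_mul_rpow_neg_le hlt (C / κ + 1)).and
    self_mem_nhdsWithin)).exists
  have hscaled : (C + κ) * δ ^ (-β) ≤ κ * δ ^ (-α) := by
    calc (C + κ) * δ ^ (-β) = κ * ((C / κ + 1) * δ ^ (-β)) := by field_simp
      _ ≤ κ * δ ^ (-α) := by gcongr
  linarith [mul_pos hκ (Real.rpow_pos_of_pos h0 (-β))]

theorem exists_separated_finset {p q δ : ℝ} (hpq : p ≤ q) (hδ : 0 < δ) :
    ∃ F : Finset ℝ, (∀ x ∈ F, x ∈ Icc p q) ∧ (q - p) / δ ≤ F.card ∧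
      ∀ x ∈ F, ∀ y ∈ F, x ≠ y → δ ≤ dist x y := by
  have hnonneg : 0 ≤ (q - p) / δ := div_nonneg (sub_nonneg.2 hpq) hδ.le
  let point (i : ℕ) : ℝ := p + i * δ
  have hdist (i j : ℕ) : dist (point i) (point j) = dist i j * δ := by
    simp only [point, dist_add_left]
    rw [Real.dist_eq, ← sub_mul, abs_mul, abs_of_pos hδ, Nat.dist_eq]
  have hinj : Function.Injective point := fun i j hij => by
    simpa [hij, hδ.ne'] using hdist i j
  refine ⟨(Finset.range (⌊(q - p) / δ⌋₊ + 1)).image point, ?_, ?_, ?_⟩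
  · intro x hx
    obtain ⟨i, hi, rfl⟩ := Finset.mem_image.1 hx
    have hle : (i : ℝ) ≤ (q - p) / δ :=
      (Nat.le_floor_iff hnonneg).1 (Nat.lt_succ_iff.1 (Finset.mem_range.1 hi))
    rw [le_div_iff₀ hδ] at hle
    exact ⟨le_add_of_nonneg_right (by positivity), by linarith⟩
  · rw [Finset.card_image_of_injective _ hinj, Finset.card_range, Nat.cast_succ]
    exact (Nat.lt_floor_add_one _).le
  · intro x hx y hy hxy
    obtain ⟨i, -, rfl⟩ := Finset.mem_image.1 hx
    obtain ⟨j, -, rfl⟩ := Finset.mem_image.1 hy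
    rw [hdist]
    exact le_mul_of_one_le_left hδ.le (Nat.pairwise_one_le_dist (fun h => hxy (h ▸ rfl)))

/-- `E` has covering exponent `t` if for some constant `C` it can be covered by at most
`C * δ ^ (-t)` closed balls of radius `δ`, for all small `δ > 0`. The upper Minkowski dimension
of a nonempty bounded subset of `ℝⁿ` is the infimum of its covering exponents. -/
def HasCoveringExponent [PseudoMetricSpace X] (E : Set X) (t : ℝ) : Prop :=
  ∃ C : ℝ, ∀ᶠ δ in 𝓝[>] (0 : ℝ), ∃ N : Finset X, (N.card : ℝ) ≤ C * δ ^ (-t) ∧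
    ∀ x ∈ E, ∃ y ∈ N, dist x y ≤ δ

namespace HasCoveringExponent

variable [PseudoMetricSpace X] [PseudoMetricSpace Y] {E F : Set X} {s t : ℝ}

theorem of_dist_le_mul {K C : ℝ} (hK : 0 < K)
    (h : ∀ᶠ δ in 𝓝[>] (0 : ℝ), ∃ N : Finset X, (N.card : ℝ) ≤ C * δ ^ (-t) ∧
      ∀ x ∈ E, ∃ y ∈ N, dist x y ≤ K * δ) : HasCoveringExponent E t := by
  refine ⟨C * K ^ t, ?_⟩
  filter_upwards [(tendsto_div_nhdsGT_zero hK).eventually h, self_mem_nhdsWithin]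
    with δ ⟨N, hcard, hN⟩ (h0 : 0 < δ)
  refine ⟨N, hcard.trans_eq ?_, fun x hx => ?_⟩
  · rw [div_rpow_neg h0.le hK.le, mul_assoc]
  · simpa only [mul_div_cancel₀ δ hK.ne'] using hN x hx

theorem nonneg (h : HasCoveringExponent E t) (hE : E.Nonempty) : 0 ≤ t := by
  obtain ⟨C, hC⟩ := h
  obtain ⟨x, hx⟩ := hE
  refine exponent_le_of_eventually_le (κ := 1) (C := C) one_pos ?_
  filter_upwards [hC] with δ ⟨N, hcard, hN⟩
  obtain ⟨y, hy, -⟩ := hN x hx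
  rw [neg_zero, Real.rpow_zero, mul_one]
  exact (Nat.one_le_cast.2 (Finset.card_pos.2 ⟨y, hy⟩)).trans hcard

theorem isBounded (h : HasCoveringExponent E t) : Bornology.IsBounded E := by
  obtain ⟨C, hC⟩ := h
  obtain ⟨δ, N, -, hN⟩ := hC.exists
  refine ((Bornology.isBounded_biUnion_finset N).2 fun y _ =>
    Metric.isBounded_closedBall (x := y) (r := δ)).subset fun x hx => ?_
  obtain ⟨y, hy, hxy⟩ := hN x hx
  exact mem_biUnion hy hxy

theorem closure (h : HasCoveringExponent E t) : HasCoveringExponent (closure E) t := by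
  obtain ⟨C, hC⟩ := h
  refine ⟨C, hC.mono fun δ ⟨N, hcard, hN⟩ => ⟨N, hcard, ?_⟩⟩
  have hclosed : IsClosed (⋃ y ∈ N, Metric.closedBall y δ) :=
    N.finite_toSet.isClosed_biUnion fun y _ => Metric.isClosed_closedBall
  have hsub : _root_.closure E ⊆ ⋃ y ∈ N, Metric.closedBall y δ :=
    closure_minimal (fun x hx => by simpa using hN x hx) hclosed
  exact fun x hx => by simpa using hsub hx

theorem union (hE : HasCoveringExponent E t) (hF : HasCoveringExponent F t) :
    HasCoveringExponent (E ∪ F) t := by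
  classical
  obtain ⟨C, hC⟩ := hE
  obtain ⟨D, hD⟩ := hF
  refine ⟨C + D, ?_⟩
  filter_upwards [hC, hD] with δ ⟨N, hcardN, hN⟩ ⟨P, hcardP, hP⟩
  refine ⟨N ∪ P, ?_, ?_⟩
  · rw [add_mul]
    exact (Nat.cast_le.2 (Finset.card_union_le N P)).trans
      (by push_cast; exact add_le_add hcardN hcardP)
  · rintro x (hx | hx)
    · obtain ⟨y, hy, hxy⟩ := hN x hx
      exact ⟨y, Finset.mem_union_left P hy, hxy⟩
    · obtain ⟨y, hy, hxy⟩ := hP x hx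
      exact ⟨y, Finset.mem_union_right N hy, hxy⟩

theorem image (h : HasCoveringExponent E t) {f : X → Y} {K : NNReal} (hf : LipschitzWith K f) :
    HasCoveringExponent (f '' E) t := by
  classical
  obtain ⟨C, hC⟩ := h
  refine of_dist_le_mul (K := K + 1) (C := C) (by positivity) ?_
  filter_upwards [hC] with δ ⟨N, hcard, hN⟩
  refine ⟨N.image f, (Nat.cast_le.2 Finset.card_image_le).trans hcard, ?_⟩
  rintro _ ⟨x, hx, rfl⟩
  obtain ⟨y, hy, hxy⟩ := hN x hx
  refine ⟨f y, Finset.mem_image_of_mem f hy, ?_⟩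
  calc dist (f x) (f y) ≤ K * dist x y := hf.dist_le_mul x y
    _ ≤ (K + 1) * δ := by gcongr; exact le_add_of_nonneg_right zero_le_one

theorem prod {F : Set Y} (hE : HasCoveringExponent E t) (hF : HasCoveringExponent F s) :
    HasCoveringExponent (E ×ˢ F) (t + s) := by
  obtain ⟨C, hC⟩ := hE
  obtain ⟨D, hD⟩ := hF
  refine ⟨C * D, ?_⟩
  filter_upwards [hC, hD, self_mem_nhdsWithin] with δ ⟨N, hcardN, hN⟩ ⟨P, hcardP, hP⟩ (h0 : 0 < δ)
  refine ⟨N ×ˢ P, ?_, ?_⟩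
  · rw [Finset.card_product, Nat.cast_mul, neg_add, Real.rpow_add h0, mul_mul_mul_comm]
    exact mul_le_mul hcardN hcardP (Nat.cast_nonneg _) ((Nat.cast_nonneg _).trans hcardN)
  · rintro ⟨x, u⟩ ⟨hx, hu⟩
    obtain ⟨y, hy, hxy⟩ := hN x hx
    obtain ⟨v, hv, huv⟩ := hP u hu
    exact ⟨(y, v), Finset.mk_mem_product hy hv, max_le hxy huv⟩

theorem Icc (a b : ℝ) : HasCoveringExponent (Set.Icc a b) 1 := by
  refine ⟨|b - a| + 1, ?_⟩
  filter_upwards [Ioo_mem_nhdsGT zero_lt_one] with δ ⟨h0, h1⟩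
  refine ⟨(Finset.range (⌊|b - a| / δ⌋₊ + 1)).image fun i : ℕ => a + i * δ, ?_, ?_⟩
  · have hfloor : ((⌊|b - a| / δ⌋₊ : ℕ) : ℝ) ≤ |b - a| / δ := Nat.floor_le (by positivity)
    have hone : 1 ≤ 1 / δ := (one_le_div h0).2 h1.le
    calc _ ≤ ((⌊|b - a| / δ⌋₊ + 1 : ℕ) : ℝ) :=
          Nat.cast_le.2 (Finset.card_image_le.trans_eq (Finset.card_range _))
      _ ≤ |b - a| / δ + 1 / δ := by push_cast; exact add_le_add hfloor hone
      _ = _ := by rw [Real.rpow_neg_one, ← add_div, div_eq_mul_inv]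
  · rintro x ⟨hax, hxb⟩
    have hnonneg : 0 ≤ (x - a) / δ := div_nonneg (sub_nonneg.2 hax) h0.le
    have hmem : ⌊(x - a) / δ⌋₊ ∈ Finset.range (⌊|b - a| / δ⌋₊ + 1) := by
      refine Finset.mem_range_succ_iff.2 (Nat.floor_mono (div_le_div_of_nonneg_right ?_ h0.le))
      exact (sub_le_sub_right hxb a).trans (le_abs_self _)
    refine ⟨a + ⌊(x - a) / δ⌋₊ * δ, Finset.mem_image.2 ⟨_, hmem, rfl⟩, ?_⟩
    have hle := (le_div_iff₀ h0).1 (Nat.floor_le hnonneg)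
    have hlt := (div_lt_iff₀ h0).1 (Nat.lt_floor_add_one ((x - a) / δ))
    rw [Real.dist_eq, abs_le]
    constructor <;> linarith

theorem image_mul_add {E : Set ℝ} (h : HasCoveringExponent E t) (α γ : ℝ) :
    HasCoveringExponent ((fun x => α * x + γ) '' E) t :=
  h.image ((lipschitzWith_smul α).add (LipschitzWith.const γ))

theorem image_linear_combination {D E : Set ℝ} (hD : HasCoveringExponent D s)
    (hE : HasCoveringExponent E t) (α β γ : ℝ) :
    HasCoveringExponent ((fun z : ℝ × ℝ => α * z.1 + β * z.2 + γ) '' D ×ˢ E) (s + t) :=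
  (hD.prod hE).image ((((lipschitzWith_smul α).comp LipschitzWith.prod_fst).add
    ((lipschitzWith_smul β).comp LipschitzWith.prod_snd)).add (LipschitzWith.const γ))

theorem exists_int_cells {E : Set ℝ} (h : HasCoveringExponent E t) :
    ∃ C : ℝ, ∀ᶠ δ in 𝓝[>] (0 : ℝ), ∃ P : Finset ℤ, (P.card : ℝ) ≤ C * δ ^ (-t) ∧
      ∀ x ∈ E, ∀ k : ℤ, |x - k * δ| ≤ δ → k ∈ P := by
  obtain ⟨C, hC⟩ := h
  refine ⟨C * 5, ?_⟩
  filter_upwards [hC, self_mem_nhdsWithin] with δ ⟨N, hcard, hN⟩ (h0 : 0 < δ)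
  refine ⟨N.biUnion fun y => Finset.Icc (⌊y / δ⌋ - 2) (⌊y / δ⌋ + 2), ?_, fun x hx k hk => ?_⟩
  · have hcells : (N.biUnion fun y => Finset.Icc (⌊y / δ⌋ - 2) (⌊y / δ⌋ + 2)).card ≤ N.card * 5 :=
      Finset.card_biUnion_le_card_mul _ _ _ fun y _ => by rw [Int.card_Icc]; omega
    calc _ ≤ (N.card : ℝ) * 5 := by exact_mod_cast hcells
      _ ≤ C * δ ^ (-t) * 5 := by gcongr
      _ = _ := by ring
  · obtain ⟨y, hy, hxy⟩ := hN x hx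
    rw [Real.dist_eq, abs_le] at hxy
    rw [abs_le] at hk
    have hlower : ((k - 2 : ℤ) : ℝ) ≤ y / δ := by
      rw [le_div_iff₀ h0]
      push_cast
      linarith
    have hupper : y / δ ≤ ((k + 2 : ℤ) : ℝ) := by
      rw [div_le_iff₀ h0]
      push_cast
      linarith
    refine Finset.mem_biUnion.2 ⟨y, hy, Finset.mem_Icc.2 ⟨?_, ?_⟩⟩
    · have := Int.floor_le_floor hupper
      rw [Int.floor_intCast] at this
      linarith
    · have := Int.le_floor.2 hlower
      linarith

theorem slice {E : Set (X × ℝ)} (h : HasCoveringExponent E s) {p q : ℝ} (hpq : p < q) :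
    HasCoveringExponent {u | ∀ y ∈ Set.Icc p q, (u, y) ∈ E} (s - 1) := by
  classical
  obtain ⟨C, hC⟩ := h
  refine ⟨3 * C / (q - p), ?_⟩
  filter_upwards [hC, self_mem_nhdsWithin] with δ ⟨N, hcard, hN⟩ (h0 : 0 < δ)
  obtain ⟨F, hFmem, hFcard, hFsep⟩ :=
    exists_separated_finset hpq.le (mul_pos three_pos h0)
  have hF : 0 < (F.card : ℝ) := (div_pos (sub_pos.2 hpq) (by positivity)).trans_le hFcard
  let strip (y : ℝ) : Finset (X × ℝ) := N.filter fun n => dist n.2 y ≤ δ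
  have hdisjoint : (F : Set ℝ).PairwiseDisjoint strip := by
    intro y hy z hz hyz
    refine Finset.disjoint_left.2 fun n hn hn' => ?_
    have hny := (Finset.mem_filter.1 hn).2
    have hnz := (Finset.mem_filter.1 hn').2
    linarith [hFsep y hy z hz hyz, dist_triangle_left y z n.2]
  have hsum : ∑ y ∈ F, ((strip y).card : ℝ) ≤ ∑ _y ∈ F, (N.card : ℝ) / F.card := by
    rw [Finset.sum_const, nsmul_eq_mul, mul_div_cancel₀ _ hF.ne', ← Nat.cast_sum,
      ← Finset.card_biUnion hdisjoint]
    exact Nat.cast_le.2 (Finset.card_le_card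
      (Finset.biUnion_subset.2 fun y _ => Finset.filter_subset _ N))
  obtain ⟨y, hy, hstrip⟩ := Finset.exists_le_of_sum_le
    (Finset.card_pos.1 (Nat.cast_pos.1 hF)) hsum
  refine ⟨(strip y).image Prod.fst, ?_, fun u hu => ?_⟩
  · calc (((strip y).image Prod.fst).card : ℝ) ≤ (strip y).card :=
          Nat.cast_le.2 Finset.card_image_le
      _ ≤ N.card / F.card := hstrip
      _ ≤ C * δ ^ (-s) / ((q - p) / (3 * δ)) := by
        have : 0 < (q - p) / (3 * δ) := div_pos (sub_pos.2 hpq) (by positivity)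
        gcongr
        exact (Nat.cast_nonneg _).trans hcard
      _ = 3 * C / (q - p) * δ ^ (-(s - 1)) := by
        rw [neg_sub, sub_eq_neg_add 1 s, Real.rpow_add_one h0.ne']
        field_simp
  · obtain ⟨n, hn, hdist⟩ := hN _ (hu y (hFmem y hy))
    rw [Prod.dist_eq, max_le_iff] at hdist
    exact ⟨n.1, Finset.mem_image_of_mem _
      (Finset.mem_filter.2 ⟨hn, (dist_comm _ _).trans_le hdist.2⟩), hdist.1⟩

theorem one_le_of_Icc_subset {E : Set ℝ} (h : HasCoveringExponent E t) {p q : ℝ} (hpq : p < q)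
    (hE : Set.Icc p q ⊆ E) : 1 ≤ t := by
  have hprod := h.image (LipschitzWith.prodMk_left ())
  have hslice := hprod.slice hpq
  exact sub_nonneg.1 (hslice.nonneg ⟨(), fun y hy => mem_image_of_mem _ (hE hy)⟩)

end HasCoveringExponent

end CoveringExponent

section Dimension

variable {n : ℕ} {E : Set (Fin n → ℝ)}

theorem boxCoveringNumber_le_card {ε : ℝ} {N : Finset (Fin n → ℝ)} (hN : N.Nonempty)
    (hE : ∀ x ∈ E, ∃ y ∈ N, dist x y ≤ ε / 2) : boxCoveringNumber E ε ≤ N.card := by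
  let center (j : Fin N.card) : Fin n → ℝ := N.equivFin.symm j
  refine iInf₂_le N.card ⟨Finset.card_pos.2 hN, fun j i => center j i - ε / 2,
    fun j i => center j i + ε / 2, fun j i => by ring_nf; exact le_rfl, fun x hx => ?_⟩
  obtain ⟨y, hy, hxy⟩ := hE x hx
  have hcenter : center (N.equivFin ⟨y, hy⟩) = y :=
    congrArg Subtype.val (N.equivFin.symm_apply_apply ⟨y, hy⟩)
  have habs (i : Fin n) : |x i - y i| ≤ ε / 2 := (dist_le_pi_dist x y i).trans hxy
  refine mem_iUnion.2 ⟨N.equivFin ⟨y, hy⟩, fun i => ?_, fun i => ?_⟩ <;>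
  · simp only [hcenter]
    linarith [abs_le.1 (habs i)]

theorem exists_finset_of_boxCoveringNumber_lt_top {ε : ℝ} (hε : 0 ≤ ε)
    (h : boxCoveringNumber E ε < ⊤) :
    ∃ N : Finset (Fin n → ℝ), (N.card : ℕ∞) ≤ boxCoveringNumber E ε ∧
      ∀ x ∈ E, ∃ y ∈ N, dist x y ≤ ε := by
  classical
  set S : Set ℕ := {k | 0 < k ∧ ∃ l u : Fin k → Fin n → ℝ,
    (∀ j i, u j i - l j i ≤ ε) ∧ E ⊆ ⋃ j, Icc (l j) (u j)}
  have hinf : boxCoveringNumber E ε = ⨅ k ∈ S, (k : ℕ∞) := rfl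
  have hne : S.Nonempty := by
    by_contra! hempty
    rw [hinf, hempty, iInf_emptyset] at h
    exact lt_irrefl _ h
  obtain ⟨-, l, u, hlu, hE⟩ := Nat.sInf_mem hne
  refine ⟨Finset.univ.image l, ?_, fun x hx => ?_⟩
  · rw [hinf]
    refine le_iInf₂ fun k hk => Nat.cast_le.2 (Finset.card_image_le.trans ?_)
    rw [Finset.card_univ, Fintype.card_fin]
    exact Nat.sInf_le hk
  · obtain ⟨j, hlx, hxu⟩ := mem_iUnion.1 (hE hx)
    refine ⟨l j, Finset.mem_image_of_mem _ (Finset.mem_univ _), (dist_pi_le_iff hε).2 fun i => ?_⟩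
    rw [Real.dist_eq, abs_of_nonneg (sub_nonneg.2 (hlx i))]
    exact (sub_le_sub_right (hxu i) _).trans (hlu j i)

theorem log_div_log_inv_le_iff {N : ENNReal} {ε : ℝ} (h0 : 0 < ε) (h1 : ε < 1) (t : ℝ) :
    ENNReal.log N / ((Real.log (1 / ε) : ℝ) : EReal) ≤ (t : EReal) ↔
      N ≤ ENNReal.ofReal (ε ^ (-t)) := by
  have hlog : 0 < Real.log (1 / ε) := Real.log_pos ((one_lt_div h0).2 h1)
  have hpow : ENNReal.log (ENNReal.ofReal (ε ^ (-t))) = ((t * Real.log (1 / ε) : ℝ) : EReal) := by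
    rw [ENNReal.log_ofReal_of_pos (Real.rpow_pos_of_pos h0 _), Real.log_rpow h0, one_div,
      Real.log_inv, mul_neg, neg_mul]
  rw [EReal.div_le_iff_le_mul (EReal.coe_pos.2 hlog) (EReal.coe_ne_top _), ← EReal.coe_mul,
    mul_comm, ← hpow, ENNReal.log_le_log_iff]

theorem hasCoveringExponent_of_minkowskiDim_lt {t : ℝ} (h : minkowskiDim E < t) :
    HasCoveringExponent E t := by
  refine ⟨1, ?_⟩
  filter_upwards [eventually_lt_of_limsup_lt h, Ioo_mem_nhdsGT zero_lt_one] with ε hε ⟨h0, h1⟩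
  have hnumber := (log_div_log_inv_le_iff h0 h1 t).1 hε.le
  obtain ⟨N, hN, hE⟩ := exists_finset_of_boxCoveringNumber_lt_top h0.le
    (ENat.toENNReal_lt_top.1 (hnumber.trans_lt ENNReal.ofReal_lt_top))
  refine ⟨N, ?_, hE⟩
  have hcard := (ENat.toENNReal_le.2 hN).trans hnumber
  rwa [ENat.toENNReal_coe, ← ENNReal.ofReal_natCast,
    ENNReal.ofReal_le_ofReal_iff (by positivity), ← one_mul (ε ^ (-t))] at hcard

theorem HasCoveringExponent.minkowskiDim_le {t : ℝ} (h : HasCoveringExponent E t)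
    (hne : E.Nonempty) : minkowskiDim E ≤ t := by
  obtain ⟨C, hC⟩ := h
  refine EReal.le_of_forall_lt_iff_le.1 fun z hz => ?_
  refine limsup_le_of_le (h := ?_)
  filter_upwards [(tendsto_div_nhdsGT_zero two_pos).eventually hC, Ioo_mem_nhdsGT zero_lt_one,
    eventually_mul_rpow_neg_le (EReal.coe_lt_coe_iff.1 hz) (C * 2 ^ t)]
    with ε ⟨N, hcard, hE⟩ ⟨h0, h1⟩ hle
  obtain ⟨x, hx⟩ := hne
  obtain ⟨y, hy, -⟩ := hE x hx
  rw [log_div_log_inv_le_iff h0 h1]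
  refine (ENat.toENNReal_le.2 (boxCoveringNumber_le_card ⟨y, hy⟩ hE)).trans ?_
  rw [ENat.toENNReal_coe, ← ENNReal.ofReal_natCast]
  rw [div_rpow_neg h0.le zero_le_two, ← mul_assoc] at hcard
  exact ENNReal.ofReal_le_ofReal (hcard.trans hle)

theorem packingDim_le_minkowskiDim (E : Set (Fin n → ℝ)) : packingDim E ≤ minkowskiDim E :=
  (iInf₂_le (fun _ => E) (subset_iUnion (fun _ : ℕ => E) 0)).trans_eq ciSup_const

theorem minPackingDim_le_minMinkowskiDim (S : Set (Fin 2 → ℝ)) :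
    minPackingDim S ≤ minMinkowskiDim S :=
  iInf₂_mono fun B _ => packingDim_le_minkowskiDim B

end Dimension

section SigmaCoveringExponent

variable {X Y : Type*} [PseudoMetricSpace X] [PseudoMetricSpace Y] {s : ℝ}

theorem exists_rat_Icc_subset_of_Icc_subset_iUnion {ι : Type*} [Countable ι] {f : ι → Set ℝ}
    (hf : ∀ i, IsClosed (f i)) {a b : ℝ} (hab : a < b) (h : Icc a b ⊆ ⋃ i, f i) :
    ∃ i, ∃ p q : ℚ, p < q ∧ Icc (p : ℝ) q ⊆ f i := by
  obtain ⟨i, hi⟩ : ∃ i, (interior (f i)).Nonempty := by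
    by_contra! hempty
    refine not_isMeagre_of_isOpen isOpen_Ioo (nonempty_Ioo.2 hab)
      ((isMeagre_iUnion fun i => ?_).mono (Ioo_subset_Icc_self.trans h))
    exact ((hf i).isNowhereDense_iff.2 (hempty i)).isMeagre
  obtain ⟨x, hx⟩ := hi
  obtain ⟨r, hr, hball⟩ := Metric.isOpen_iff.1 isOpen_interior x hx
  obtain ⟨p, hrp, hpx⟩ := exists_rat_btwn (sub_lt_self x hr)
  obtain ⟨q, hxq, hqr⟩ := exists_rat_btwn (lt_add_of_pos_right x hr)
  refine ⟨i, p, q, Rat.cast_lt.1 (hpx.trans hxq), fun y hy => interior_subset (hball ?_)⟩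
  rw [Real.ball_eq_Ioo]
  exact ⟨hrp.trans_le hy.1, hy.2.trans_lt hqr⟩

/-- `E` is contained in a countable union of sets with covering exponent `s`. The packing dimension
of a subset of `ℝⁿ` is the infimum of the `s` with this property. -/
def HasSigmaCoveringExponent (E : Set X) (s : ℝ) : Prop :=
  ∃ F : ℕ → Set X, (∀ j, HasCoveringExponent (F j) s) ∧ E ⊆ ⋃ j, F j

theorem hasSigmaCoveringExponent_of_packingDim_lt {n : ℕ} {E : Set (Fin n → ℝ)}
    (h : packingDim E < s) : HasSigmaCoveringExponent E s := by
  simp only [packingDim, iInf_lt_iff] at h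
  obtain ⟨F, hF, hs⟩ := h
  exact ⟨F, fun j => hasCoveringExponent_of_minkowskiDim_lt ((le_iSup _ j).trans_lt hs), hF⟩

namespace HasSigmaCoveringExponent

theorem of_countable {ι : Type*} [Countable ι] [Nonempty ι] {E : Set X} {F : ι → Set X}
    (hF : ∀ i, HasCoveringExponent (F i) s) (hE : E ⊆ ⋃ i, F i) :
    HasSigmaCoveringExponent E s := by
  obtain ⟨e, he⟩ := exists_surjective_nat ι
  exact ⟨F ∘ e, fun j => hF (e j), hE.trans_eq (he.iUnion_comp F).symm⟩

theorem mono {E F : Set X} (h : HasSigmaCoveringExponent F s) (hEF : E ⊆ F) :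
    HasSigmaCoveringExponent E s := by
  obtain ⟨G, hG, hF⟩ := h
  exact ⟨G, hG, hEF.trans hF⟩

theorem image {E : Set X} (h : HasSigmaCoveringExponent E s) {f : X → Y} {K : NNReal}
    (hf : LipschitzWith K f) : HasSigmaCoveringExponent (f '' E) s := by
  obtain ⟨F, hF, hE⟩ := h
  exact ⟨fun j => f '' F j, fun j => (hF j).image hf, by
    rw [← image_iUnion]; exact image_mono hE⟩

theorem exists_monotone_isClosed {E : Set X} (h : HasSigmaCoveringExponent E s) :
    ∃ F : ℕ → Set X, Monotone F ∧ (∀ j, IsClosed (F j)) ∧ (∀ j, HasCoveringExponent (F j) s) ∧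
      E ⊆ ⋃ j, F j := by
  obtain ⟨F, hF, hE⟩ := h
  have haccumulate (j : ℕ) : HasCoveringExponent (accumulate F j) s := by
    induction j with
    | zero => simpa only [accumulate_zero_nat] using hF 0
    | succ j ih => simpa only [accumulate_succ] using ih.union (hF (j + 1))
  refine ⟨fun j => closure (accumulate F j), fun i j hij => closure_mono (monotone_accumulate hij),
    fun j => isClosed_closure, fun j => (haccumulate j).closure, ?_⟩
  exact hE.trans (iUnion_mono fun j => subset_accumulate.trans subset_closure)

theorem slice {E : Set (X × ℝ)} (h : HasSigmaCoveringExponent E s) :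
    HasSigmaCoveringExponent {u | ∃ p q : ℝ, p < q ∧ ∀ y ∈ Icc p q, (u, y) ∈ E} (s - 1) := by
  obtain ⟨F, -, hclosed, hF, hE⟩ := h.exists_monotone_isClosed
  have hnonempty : Nonempty {r : ℚ × ℚ // r.1 < r.2} := ⟨⟨(0, 1), zero_lt_one⟩⟩
  refine of_countable (ι := ℕ × {r : ℚ × ℚ // r.1 < r.2})
    (F := fun i => {u | ∀ y ∈ Icc (i.2.1.1 : ℝ) i.2.1.2, (u, y) ∈ F i.1})
    (fun i => (hF i.1).slice (Rat.cast_lt.2 i.2.2)) ?_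
  rintro u ⟨p, q, hpq, hu⟩
  obtain ⟨j, p', q', hpq', hsub⟩ := exists_rat_Icc_subset_of_Icc_subset_iUnion
    (f := fun j => Prod.mk u ⁻¹' F j) (fun j => (hclosed j).preimage (by fun_prop)) hpq
    (fun y hy => by rw [← preimage_iUnion]; exact hE (hu y hy))
  exact mem_iUnion.2 ⟨(j, ⟨(p', q'), hpq'⟩), hsub⟩

end HasSigmaCoveringExponent

end SigmaCoveringExponent

section SideCoordinates

theorem segment_eq_image_graph {a b : ℝ} (hab : a ≤ b) (c : ℝ) :
    segment ℝ ![a, c * a] ![b, c * b] = (fun x => ![x, c * x]) '' Icc a b := by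
  let graph : ℝ →ₗ[ℝ] Fin 2 → ℝ := LinearMap.toSpanSingleton ℝ _ ![1, c]
  have hgraph (x : ℝ) : graph x = ![x, c * x] := by
    simp only [graph, LinearMap.toSpanSingleton_apply, Matrix.smul_cons, smul_eq_mul, mul_comm x,
      one_mul, Matrix.smul_empty]
  have himage := image_segment ℝ graph.toAffineMap a b
  simp only [LinearMap.coe_toAffineMap, hgraph, segment_eq_Icc hab] at himage
  exact himage.symm

theorem forall_unitSquare_add_smul_mem_iff {B : Set (Fin 2 → ℝ)} {x : Fin 2 → ℝ} {r : ℝ}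
    (hr : 0 < r) :
    (∀ p ∈ unitSquare, x + r • p ∈ B) ↔
      ∀ u v, max |u - x 0| |v - x 1| = r → ![u, v] ∈ B := by
  constructor
  · intro h u v huv
    have hp : ![(u - x 0) / r, (v - x 1) / r] ∈ unitSquare := by
      change max |(u - x 0) / r| |(v - x 1) / r| = 1
      rw [abs_div, abs_div, abs_of_pos hr, max_div_div_right hr.le, huv, div_self hr.ne']
    convert h _ hp using 1
    ext i
    fin_cases i <;> simp [mul_div_cancel₀ _ hr.ne']
  · intro h p hp
    convert h (x 0 + r * p 0) (x 1 + r * p 1) ?_ using 1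
    · ext i
      fin_cases i <;> rfl
    · rw [add_sub_cancel_left, add_sub_cancel_left, abs_mul, abs_mul, abs_of_pos hr,
        ← mul_max_of_nonneg _ _ hr.le, show max |p 0| |p 1| = 1 from hp, mul_one]

/-- Over every `x ∈ I` there is a square centred at `(x, c x)` whose vertical sides have abscissae
in `X` and whose horizontal sides have ordinates in `Y`. -/
def HasSideCoordinates (c : ℝ) (I X Y : Set ℝ) : Prop :=
  ∀ x ∈ I, ∃ r > 0, (x - r ∈ X ∧ x + r ∈ X) ∧ c * x - r ∈ Y ∧ c * x + r ∈ Y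

theorem ContainsSquares.hasSideCoordinates {a b c : ℝ} (hab : a ≤ b) {B : Set (Fin 2 → ℝ)}
    (h : ContainsSquares (segment ℝ ![a, c * a] ![b, c * b]) B) :
    HasSideCoordinates c (Icc a b) {u | ∃ p q : ℝ, p < q ∧ ∀ v ∈ Icc p q, ![u, v] ∈ B}
      {v | ∃ p q : ℝ, p < q ∧ ∀ u ∈ Icc p q, ![u, v] ∈ B} := by
  intro x hx
  obtain ⟨r, hr, hsquare⟩ :=
    h ![x, c * x] (segment_eq_image_graph hab c ▸ mem_image_of_mem _ hx)
  replace hsquare := (forall_unitSquare_add_smul_mem_iff hr).1 hsquare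
  have hvertical (u) (hu : |u - x| = r) (v) (hv : v ∈ Icc (c * x - r) (c * x + r)) :
      ![u, v] ∈ B :=
    hsquare u v ((max_eq_left ((abs_sub_le_iff.2 ⟨by linarith [hv.2], by
      linarith [hv.1]⟩ : |v - c * x| ≤ r).trans_eq hu.symm)).trans hu)
  have hhorizontal (v) (hv : |v - c * x| = r) (u) (hu : u ∈ Icc (x - r) (x + r)) :
      ![u, v] ∈ B :=
    hsquare u v ((max_eq_right ((abs_sub_le_iff.2 ⟨by linarith [hu.2], by
      linarith [hu.1]⟩ : |u - x| ≤ r).trans_eq hv.symm)).trans hv)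
  have hleft (y : ℝ) : |y - r - y| = r := by rw [sub_sub_cancel_left, abs_neg, abs_of_pos hr]
  have hright (y : ℝ) : |y + r - y| = r := by rw [add_sub_cancel_left, abs_of_pos hr]
  exact ⟨r, hr, ⟨⟨_, _, by linarith, hvertical _ (hleft x)⟩, _, _, by linarith,
    hvertical _ (hright x)⟩, ⟨_, _, by linarith, hhorizontal _ (hleft _)⟩, _, _, by linarith,
    hhorizontal _ (hright _)⟩

theorem HasSigmaCoveringExponent.vertical {B : Set (Fin 2 → ℝ)} {s : ℝ}
    (h : HasSigmaCoveringExponent B s) :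
    HasSigmaCoveringExponent {u | ∃ p q : ℝ, p < q ∧ ∀ v ∈ Icc p q, ![u, v] ∈ B} (s - 1) :=
  (h.image ((LipschitzWith.eval 0).prodMk (LipschitzWith.eval 1))).slice.mono
    fun _ ⟨p, q, hpq, hu⟩ => ⟨p, q, hpq, fun v hv => ⟨_, hu v hv, rfl⟩⟩

theorem HasSigmaCoveringExponent.horizontal {B : Set (Fin 2 → ℝ)} {s : ℝ}
    (h : HasSigmaCoveringExponent B s) :
    HasSigmaCoveringExponent {v | ∃ p q : ℝ, p < q ∧ ∀ u ∈ Icc p q, ![u, v] ∈ B} (s - 1) :=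
  (h.image ((LipschitzWith.eval 1).prodMk (LipschitzWith.eval 0))).slice.mono
    fun _ ⟨p, q, hpq, hv⟩ => ⟨p, q, hpq, fun u hu => ⟨_, hv u hu, rfl⟩⟩

namespace HasSideCoordinates

variable {a b c p q t : ℝ} {I X Y : Set ℝ}

theorem image_affine (h : HasSideCoordinates c I X Y) {l : ℝ} (hl : 0 < l) (m : ℝ) :
    HasSideCoordinates c ((fun x => l * x + m) '' I) ((fun x => l * x + m) '' X)
      ((fun y => l * y + c * m) '' Y) := by
  rintro _ ⟨x, hx, rfl⟩
  obtain ⟨r, hr, ⟨hX, hX'⟩, hY, hY'⟩ := h x hx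
  exact ⟨l * r, mul_pos hl hr, ⟨⟨_, hX, by ring⟩, _, hX', by ring⟩, ⟨_, hY, by ring⟩, _, hY',
    by ring⟩

theorem containsSquares (h : HasSideCoordinates c (Icc a b) X Y) (hab : a ≤ b) {J : Set ℝ}
    (hJ : J.OrdConnected) (hXJ : X ⊆ J) (hYJ : Y ⊆ J) :
    ContainsSquares (segment ℝ ![a, c * a] ![b, c * b])
      ((fun z : ℝ × ℝ => ![z.1, z.2]) '' (X ×ˢ J ∪ J ×ˢ Y)) := by
  rw [segment_eq_image_graph hab]
  rintro _ ⟨x, hx, rfl⟩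
  obtain ⟨r, hr, ⟨hX, hX'⟩, hY, hY'⟩ := h x hx
  refine ⟨r, hr, (forall_unitSquare_add_smul_mem_iff hr).2 fun u v huv => ⟨(u, v), ?_, rfl⟩⟩
  change max |u - x| |v - c * x| = r at huv
  have hu := abs_sub_le_iff.1 ((le_max_left _ _).trans_eq huv)
  have hv := abs_sub_le_iff.1 ((le_max_right _ _).trans_eq huv)
  have huJ : u ∈ J := hJ.out (hXJ hX) (hXJ hX') ⟨by linarith, by linarith⟩
  have hvJ : v ∈ J := hJ.out (hYJ hY) (hYJ hY') ⟨by linarith, by linarith⟩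
  rcases max_choice |u - x| |v - c * x| with hmax | hmax <;> rw [hmax] at huv
  · refine Or.inl ⟨?_, hvJ⟩
    rcases (abs_eq hr.le).1 huv with hside | hside
    · rwa [eq_add_of_sub_eq' hside]
    · rwa [eq_add_of_sub_eq' hside]
  · refine Or.inr ⟨huJ, ?_⟩
    rcases (abs_eq hr.le).1 huv with hside | hside
    · rwa [eq_add_of_sub_eq' hside]
    · rwa [eq_add_of_sub_eq' hside]

theorem minMinkowskiDim_le (h : HasSideCoordinates c (Icc p q) X Y) (hpq : p < q)
    (hX : HasCoveringExponent X t) (hY : HasCoveringExponent Y t) (hab : a < b) :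
    minMinkowskiDim (segment ℝ ![a, c * a] ![b, c * b]) ≤ ((t + 1 : ℝ) : EReal) := by
  obtain ⟨l, m, hl, himage⟩ : ∃ l m : ℝ, 0 < l ∧ (fun x => l * x + m) '' Icc p q = Icc a b := by
    refine ⟨(b - a) / (q - p), a - (b - a) / (q - p) * p,
      div_pos (sub_pos.2 hab) (sub_pos.2 hpq), ?_⟩
    rw [image_affine_Icc' (div_pos (sub_pos.2 hab) (sub_pos.2 hpq))]
    have := sub_pos.2 hpq
    congr 1 <;> field_simp <;> ring
  replace h := himage ▸ h.image_affine hl m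
  replace hX := hX.image_mul_add l m
  replace hY := hY.image_mul_add l (c * m)
  obtain ⟨M, hM⟩ := (hX.isBounded.union hY.isBounded).subset_closedBall 0
  rw [Real.closedBall_eq_Icc, zero_sub, zero_add] at hM
  have hJ := HasCoveringExponent.Icc (-M) M
  have hsquares := h.containsSquares hab.le ordConnected_Icc (subset_union_left.trans hM)
    (subset_union_right.trans hM)
  refine (iInf₂_le _ hsquares).trans (HasCoveringExponent.minkowskiDim_le ?_ ?_)
  · exact ((hX.prod hJ).union (add_comm 1 t ▸ hJ.prod hY)).image
      (IsometryEquiv.piFinTwo fun _ => ℝ).symm.isometry.lipschitz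
  · obtain ⟨r, -, ⟨hx, -⟩, -⟩ := h a (left_mem_Icc.2 hab.le)
    exact ⟨_, (a - r, a - r), Or.inl ⟨hx, hM (Or.inl hx)⟩, rfl⟩

theorem isClosed_setOf_side_mem (hX : IsClosed X) (hY : IsClosed Y) (a b c ε R : ℝ) :
    IsClosed {x ∈ Icc a b | ∃ r ∈ Icc ε R,
      (x - r ∈ X ∧ x + r ∈ X) ∧ c * x - r ∈ Y ∧ c * x + r ∈ Y} := by
  let sides : Set (ℝ × ℝ) := {z | (z.1 - z.2 ∈ X ∧ z.1 + z.2 ∈ X) ∧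
    c * z.1 - z.2 ∈ Y ∧ c * z.1 + z.2 ∈ Y}
  have hsides : IsClosed sides :=
    ((hX.preimage (by fun_prop)).inter (hX.preimage (by fun_prop))).inter
      ((hY.preimage (by fun_prop)).inter (hY.preimage (by fun_prop)))
  have hcompact : IsCompact (Prod.fst '' ((Icc a b ×ˢ Icc ε R) ∩ sides)) :=
    ((isCompact_Icc.prod isCompact_Icc).inter_right hsides).image continuous_fst
  convert hcompact.isClosed using 1
  ext x
  constructor
  · rintro ⟨hx, r, hr, hside⟩
    exact ⟨(x, r), ⟨⟨hx, hr⟩, hside⟩, rfl⟩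
  · rintro ⟨⟨x, r⟩, ⟨⟨hx, hr⟩, hside⟩, rfl⟩
    exact ⟨hx, r, hr, hside⟩

theorem exists_hasCoveringExponent (h : HasSideCoordinates c (Icc a b) X Y) (hab : a < b)
    (hX : HasSigmaCoveringExponent X t) (hY : HasSigmaCoveringExponent Y t) :
    ∃ (p q : ℝ) (X' Y' : Set ℝ), p < q ∧ HasSideCoordinates c (Icc p q) X' Y' ∧
      HasCoveringExponent X' t ∧ HasCoveringExponent Y' t := by
  obtain ⟨F, hFmono, hFclosed, hF, hXF⟩ := hX.exists_monotone_isClosed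
  obtain ⟨G, hGmono, hGclosed, hG, hYG⟩ := hY.exists_monotone_isClosed
  have eventually_mem {H : ℕ → Set ℝ} (hH : Monotone H) {u : ℝ} (hu : u ∈ ⋃ n, H n) :
      ∀ᶠ n in atTop, u ∈ H n := by
    obtain ⟨m, hm⟩ := mem_iUnion.1 hu
    filter_upwards [eventually_ge_atTop m] with n hn using hH hn hm
  have hcover : Icc a b ⊆ ⋃ n : ℕ, {x ∈ Icc a b | ∃ r ∈ Icc (1 / ((n : ℝ) + 1)) n,
      (x - r ∈ F n ∧ x + r ∈ F n) ∧ c * x - r ∈ G n ∧ c * x + r ∈ G n} := by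
    intro x hx
    obtain ⟨r, hr, ⟨hX, hX'⟩, hY, hY'⟩ := h x hx
    obtain ⟨n, hsmall, hlarge, hsides⟩ :=
      ((tendsto_one_div_add_atTop_nhds_zero_nat.eventually_le_const hr).and
        ((tendsto_natCast_atTop_atTop.eventually_ge_atTop r).and
        (((eventually_mem hFmono (hXF hX)).and (eventually_mem hFmono (hXF hX'))).and
        ((eventually_mem hGmono (hYG hY)).and (eventually_mem hGmono (hYG hY')))))).exists
    exact mem_iUnion.2 ⟨n, hx, r, ⟨hsmall, hlarge⟩, hsides⟩
  obtain ⟨n, p, q, hpq, hsub⟩ := exists_rat_Icc_subset_of_Icc_subset_iUnion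
    (fun n => isClosed_setOf_side_mem (hFclosed n) (hGclosed n) a b c _ _) hab hcover
  refine ⟨p, q, F n, G n, Rat.cast_lt.2 hpq, fun x hx => ?_, hF n, hG n⟩
  obtain ⟨-, r, hr, hside⟩ := hsub hx
  exact ⟨r, (by positivity : 0 < 1 / ((n : ℝ) + 1)).trans_le hr.1, hside⟩

end HasSideCoordinates

theorem exists_hasSideCoordinates_of_minPackingDim_lt {a b c s : ℝ} (hab : a < b)
    (h : minPackingDim (segment ℝ ![a, c * a] ![b, c * b]) < s) :
    ∃ (p q : ℝ) (X Y : Set ℝ), p < q ∧ HasSideCoordinates c (Icc p q) X Y ∧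
      HasCoveringExponent X (s - 1) ∧ HasCoveringExponent Y (s - 1) := by
  simp only [minPackingDim, iInf_lt_iff] at h
  obtain ⟨B, hsquares, hB⟩ := h
  have hsigma := hasSigmaCoveringExponent_of_packingDim_lt hB
  exact (hsquares.hasSideCoordinates hab.le).exists_hasCoveringExponent hab hsigma.vertical
    hsigma.horizontal

theorem minMinkowskiDim_segment_eq_minPackingDim_segment {a b a' b' : ℝ} (hab : a < b)
    (hab' : a' < b') (c : ℝ) :
    minMinkowskiDim (segment ℝ ![a, c * a] ![b, c * b]) =
      minPackingDim (segment ℝ ![a', c * a'] ![b', c * b']) := by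
  have hle {a b a' b' : ℝ} (hab : a < b) (hab' : a' < b') :
      minMinkowskiDim (segment ℝ ![a, c * a] ![b, c * b]) ≤
        minPackingDim (segment ℝ ![a', c * a'] ![b', c * b']) := by
    refine EReal.le_of_forall_lt_iff_le.1 fun s hs => ?_
    obtain ⟨p, q, X, Y, hpq, hsides, hX, hY⟩ :=
      exists_hasSideCoordinates_of_minPackingDim_lt hab' hs
    simpa only [sub_add_cancel] using hsides.minMinkowskiDim_le hpq hX hY hab
  refine (hle hab hab').antisymm ?_
  calc minPackingDim (segment ℝ ![a', c * a'] ![b', c * b'])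
      ≤ minMinkowskiDim (segment ℝ ![a', c * a'] ![b', c * b']) :=
        minPackingDim_le_minMinkowskiDim _
    _ ≤ minPackingDim (segment ℝ ![a, c * a] ![b, c * b]) := hle hab' hab
    _ ≤ minMinkowskiDim (segment ℝ ![a, c * a] ![b, c * b]) := minPackingDim_le_minMinkowskiDim _

end SideCoordinates

section LowerBounds

theorem abs_sub_floor_div_mul_le {δ : ℝ} (hδ : 0 < δ) (u : ℝ) : |u - ⌊u / δ⌋ * δ| ≤ δ := by
  rw [abs_of_nonneg (Int.sub_floor_div_mul_nonneg u hδ)]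
  exact (Int.sub_floor_div_mul_lt u hδ).le

theorem card_separated_pow_six_le {F : Finset ℝ} {δ : ℝ} (hδ : 0 < δ)
    (hF : ∀ x ∈ F, ∀ y ∈ F, x ≠ y → δ ≤ dist x y) (r : ℝ → ℝ) {P Q : Finset ℤ}
    (hadd : ∀ x ∈ F, ⌊(x + r x) / δ⌋ ∈ P) (hsub : ∀ x ∈ F, ⌊(x - r x) / δ⌋ ∈ P)
    (hdiff : ∀ x ∈ F, ⌊(x + r x) / δ⌋ - ⌊(x - r x) / δ⌋ ∈ Q) :
    F.card ^ 6 ≤ P.card ^ 8 * Q.card ^ 3 := by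
  let cells (x : ℝ) : ℤ × ℤ := (⌊(x + r x) / δ⌋, ⌊(x - r x) / δ⌋)
  have hinj : InjOn (fun x => (cells x).1 + (cells x).2) F := fun x hx y hy hxy => by
    by_contra hne
    have hsum : (⌊(x + r x) / δ⌋ : ℝ) * δ + ⌊(x - r x) / δ⌋ * δ =
        ⌊(y + r y) / δ⌋ * δ + ⌊(y - r y) / δ⌋ * δ := by
      rw [← add_mul, ← add_mul]
      exact_mod_cast congrArg (fun k : ℤ => (k : ℝ) * δ) hxy
    have hclose : |x - y| < δ := by
      have hnonneg (u : ℝ) := Int.sub_floor_div_mul_nonneg u hδ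
      have hlt (u : ℝ) := Int.sub_floor_div_mul_lt u hδ
      refine abs_sub_lt_iff.2 ⟨?_, ?_⟩
      · linarith [hlt (x + r x), hlt (x - r x), hnonneg (y + r y), hnonneg (y - r y)]
      · linarith [hlt (y + r y), hlt (y - r y), hnonneg (x + r x), hnonneg (x - r x)]
    exact (hF x hx y hy hne).not_gt hclose
  have hcard : (F.image cells).card = F.card :=
    Finset.card_image_of_injOn fun x hx y hy hxy => hinj hx hy (by simp only [hxy])
  calc F.card ^ 6 = (F.image cells).card ^ 6 := by rw [hcard]
    _ ≤ ((F.image cells).image Prod.fst).card ^ 4 * ((F.image cells).image Prod.snd).card ^ 4 *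
        ((F.image cells).image fun g => g.1 - g.2).card ^ 3 :=
      card_pow_six_le_of_injOn_add (by rw [Finset.coe_image]; exact hinj.image_of_comp)
    _ ≤ P.card ^ 4 * P.card ^ 4 * Q.card ^ 3 := by
      simp only [Finset.image_image]
      gcongr
      exacts [Finset.image_subset_iff.2 hadd, Finset.image_subset_iff.2 hsub,
        Finset.image_subset_iff.2 hdiff]
    _ = P.card ^ 8 * Q.card ^ 3 := by rw [← pow_add]

namespace HasSideCoordinates

variable {a b c p q t : ℝ} {X Y : Set ℝ}

theorem one_half_le (h : HasSideCoordinates c (Icc p q) X Y) (hpq : p < q)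
    (hX : HasCoveringExponent X t) : 1 / 2 ≤ t := by
  have hsub : Icc p q ⊆ (fun z : ℝ × ℝ => 1 / 2 * z.1 + 1 / 2 * z.2 + 0) '' X ×ˢ X := by
    intro x hx
    obtain ⟨r, -, ⟨hX, hX'⟩, -⟩ := h x hx
    exact ⟨(x - r, x + r), ⟨hX, hX'⟩, by ring⟩
  linarith [(hX.image_linear_combination hX (1 / 2) (1 / 2) 0).one_le_of_Icc_subset hpq hsub]

theorem six_div_eleven_le (h : HasSideCoordinates 0 (Icc p q) X Y) (hpq : p < q)
    (hX : HasCoveringExponent X t) (hY : HasCoveringExponent Y t) : 6 / 11 ≤ t := by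
  choose! r _ hrX hrY using h
  obtain ⟨C, hC⟩ := hX.exists_int_cells
  obtain ⟨D, hD⟩ := (hY.image_mul_add 2 0).exists_int_cells
  suffices hexp : (6 : ℝ) ≤ 11 * t by linarith
  refine exponent_le_of_eventually_le (κ := (q - p) ^ 6) (C := C ^ 8 * D ^ 3)
    (pow_pos (sub_pos.2 hpq) 6) ?_
  filter_upwards [hC, hD, self_mem_nhdsWithin] with δ ⟨P, hPcard, hP⟩ ⟨Q, hQcard, hQ⟩ (h0 : 0 < δ)
  obtain ⟨F, hFsub, hFcard, hF⟩ := exists_separated_finset hpq.le h0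
  have hcard : F.card ^ 6 ≤ P.card ^ 8 * Q.card ^ 3 := by
    refine card_separated_pow_six_le h0 hF r
      (fun x hx => hP _ (hrX x (hFsub x hx)).2 _ (abs_sub_floor_div_mul_le h0 _))
      (fun x hx => hP _ (hrX x (hFsub x hx)).1 _ (abs_sub_floor_div_mul_le h0 _)) fun x hx => ?_
    refine hQ _ (mem_image_of_mem _ (hrY x (hFsub x hx)).2) _ ?_
    push_cast
    have hnonneg (u : ℝ) := Int.sub_floor_div_mul_nonneg u h0
    have hlt (u : ℝ) := Int.sub_floor_div_mul_lt u h0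
    refine abs_sub_le_iff.2 ⟨?_, ?_⟩ <;>
    linarith [hlt (x + r x), hlt (x - r x), hnonneg (x + r x), hnonneg (x - r x)]
  have hQpow : (Q.card : ℝ) ^ 3 ≤ (D * δ ^ (-t)) ^ 3 := by gcongr
  calc (q - p) ^ 6 * δ ^ (-6 : ℝ) = ((q - p) / δ) ^ 6 := by
        rw [Real.rpow_neg h0.le, div_pow, div_eq_mul_inv]
        norm_cast
    _ ≤ (F.card : ℝ) ^ 6 := by
        have := div_nonneg (sub_pos.2 hpq).le h0.le
        gcongr
    _ ≤ (P.card : ℝ) ^ 8 * (Q.card : ℝ) ^ 3 := by exact_mod_cast hcard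
    _ ≤ (C * δ ^ (-t)) ^ 8 * (D * δ ^ (-t)) ^ 3 := by gcongr
    _ = C ^ 8 * D ^ 3 * δ ^ (-(11 * t)) := by
        rw [show -(11 * t) = -t * (11 : ℕ) by push_cast; ring, Real.rpow_mul_natCast h0.le]
        ring

end HasSideCoordinates

theorem three_halves_le_minPackingDim_segment {a b : ℝ} (hab : a < b) (c : ℝ) :
    ((3 / 2 : ℝ) : EReal) ≤ minPackingDim (segment ℝ ![a, c * a] ![b, c * b]) := by
  refine EReal.le_of_forall_lt_iff_le.1 fun s hs => ?_
  obtain ⟨p, q, X, Y, hpq, hsides, hX, -⟩ := exists_hasSideCoordinates_of_minPackingDim_lt hab hs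
  have := hsides.one_half_le hpq hX
  exact_mod_cast (by linarith : 3 / 2 ≤ s)

theorem seventeen_div_eleven_le_minPackingDim_segment_zero {a b : ℝ} (hab : a < b) :
    ((17 / 11 : ℝ) : EReal) ≤ minPackingDim (segment ℝ ![a, 0 * a] ![b, 0 * b]) := by
  refine EReal.le_of_forall_lt_iff_le.1 fun s hs => ?_
  obtain ⟨p, q, X, Y, hpq, hsides, hX, hY⟩ := exists_hasSideCoordinates_of_minPackingDim_lt hab hs
  have := hsides.six_div_eleven_le hpq hX hY
  exact_mod_cast (by linarith : 17 / 11 ≤ s)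

end LowerBounds

section DigitSets

/-- The numbers in `[0, 1]` with a binary expansion whose digits vanish off the places
`≡ i (mod p)`, counting places from `0`. -/
def digitSet (p i : ℕ) : Set ℝ :=
  {x | ∃ d : ℕ → Fin 2, (∀ k, k % p ≠ i → d k = 0) ∧ Real.ofDigits d = x}

theorem digitSet_subset_Icc (p i : ℕ) : digitSet p i ⊆ Icc 0 1 := by
  rintro _ ⟨d, -, rfl⟩
  exact ⟨Real.ofDigits_nonneg d, Real.ofDigits_le_one d⟩

theorem exists_finset_dist_digitSet_le (p i n : ℕ) :
    ∃ N : Finset ℝ, N.card ≤ 2 ^ n ∧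
      ∀ x ∈ digitSet p i, ∃ y ∈ N, dist x y ≤ ((2 ^ p)⁻¹ : ℝ) ^ n := by
  classical
  let truncate (f : Fin n → Fin 2) : ℝ := Real.ofDigits fun k =>
    if h : k / p < n then (if k % p = i then f ⟨k / p, h⟩ else 0) else (0 : Fin 2)
  refine ⟨Finset.univ.image truncate, ?_, ?_⟩
  · calc _ ≤ (Finset.univ : Finset (Fin n → Fin 2)).card := Finset.card_image_le
      _ = 2 ^ n := by rw [Finset.card_univ, Fintype.card_fun, Fintype.card_fin, Fintype.card_fin]
  · rintro _ ⟨d, hd, rfl⟩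
    refine ⟨_, Finset.mem_image_of_mem _ (Finset.mem_univ fun j : Fin n => d (p * j + i)), ?_⟩
    rw [Real.dist_eq]
    refine (Real.abs_ofDigits_sub_ofDigits_le (n := p * n) fun k hk => ?_).trans_eq
      (by rw [Nat.cast_ofNat, pow_mul, inv_pow])
    rw [dif_pos (Nat.div_lt_of_lt_mul hk)]
    split_ifs with hki
    · simp only [← hki, Nat.div_add_mod]
    · exact hd k hki

theorem hasCoveringExponent_digitSet {p : ℕ} (hp : 0 < p) (i : ℕ) :
    HasCoveringExponent (digitSet p i) (1 / p) := by
  have hbase : (0 : ℝ) < (2 ^ p)⁻¹ := by positivity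
  refine HasCoveringExponent.of_dist_le_mul (K := 2 ^ p) (C := 1) (by positivity) ?_
  filter_upwards [Ioo_mem_nhdsGT one_pos] with δ ⟨h0, h1⟩
  obtain ⟨n, hlt, hle⟩ := exists_nat_pow_near_of_lt_one h0 h1.le hbase
    (inv_lt_one_of_one_lt₀ (one_lt_pow₀ one_lt_two hp.ne'))
  obtain ⟨N, hcard, hN⟩ := exists_finset_dist_digitSet_le p i n
  refine ⟨N, ?_, fun x hx => ?_⟩
  · have hpow : (((2 ^ p)⁻¹ : ℝ) ^ n) ^ (-(1 / p : ℝ)) = 2 ^ n := by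
      rw [inv_pow, Real.inv_rpow (by positivity), ← Real.rpow_neg (by positivity), neg_neg,
        ← pow_mul, mul_comm, pow_mul, one_div, Real.pow_rpow_inv_natCast (by positivity) hp.ne']
    calc (N.card : ℝ) ≤ 2 ^ n := by exact_mod_cast hcard
      _ = (((2 ^ p)⁻¹ : ℝ) ^ n) ^ (-(1 / p : ℝ)) := hpow.symm
      _ ≤ δ ^ (-(1 / p : ℝ)) :=
        Real.rpow_le_rpow_of_nonpos h0 hle (neg_nonpos.2 (by positivity))
      _ = 1 * δ ^ (-(1 / p : ℝ)) := (one_mul _).symm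
  · obtain ⟨y, hy, hxy⟩ := hN x hx
    refine ⟨y, hy, hxy.trans ?_⟩
    rw [pow_succ, ← div_eq_mul_inv, div_lt_iff₀' (by positivity)] at hlt
    exact hlt.le

theorem exists_sum_digitSet {p : ℕ} (hp : 0 < p) {x : ℝ} (hx : x ∈ Icc (0 : ℝ) 1) :
    ∃ y : ℕ → ℝ, (∀ i, y i ∈ digitSet p i) ∧ x = ∑ i ∈ Finset.range p, y i := by
  obtain ⟨d, -, rfl⟩ := Real.ofDigits_SurjOn one_lt_two hx
  refine ⟨fun i => Real.ofDigits fun k => if k % p = i then d k else 0,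
    fun i => ⟨_, fun k hk => if_neg hk, rfl⟩, ?_⟩
  simp only [Real.ofDigits]
  rw [← Summable.tsum_finsetSum fun i _ => Real.summable_ofDigitsTerm]
  refine tsum_congr fun k => ?_
  rw [Finset.sum_eq_single_of_mem (k % p) (Finset.mem_range.2 (Nat.mod_lt k hp))]
  · simp only [Real.ofDigitsTerm, if_true]
  · intro j _ hj
    simp only [Real.ofDigitsTerm, if_neg hj.symm, Fin.val_zero, Nat.cast_zero, zero_mul]

end DigitSets

section UpperBounds

theorem hasSideCoordinates_zero_digitSet :
    HasSideCoordinates 0 (Icc 0 1)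
      ((fun z : ℝ × ℝ => 2 * z.1 + 1 * z.2 + 2) '' digitSet 3 1 ×ˢ digitSet 3 2 ∪
        (fun z : ℝ × ℝ => 2 * z.1 + 1 * z.2 + -2) '' digitSet 3 0 ×ˢ digitSet 3 2)
      ((fun z : ℝ × ℝ => 1 * z.1 + -1 * z.2 + 2) '' digitSet 3 1 ×ˢ digitSet 3 0 ∪
        (fun z : ℝ × ℝ => -1 * z.1 + 1 * z.2 + -2) '' digitSet 3 1 ×ˢ digitSet 3 0) := by
  intro x hx
  obtain ⟨y, hy, hsum⟩ := exists_sum_digitSet (p := 3) three_pos hx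
  obtain rfl : x = y 0 + y 1 + y 2 := by
    rw [hsum, Finset.sum_range_succ, Finset.sum_range_succ, Finset.sum_range_one]
  have h0 := digitSet_subset_Icc _ _ (hy 0)
  have h1 := digitSet_subset_Icc _ _ (hy 1)
  -- The shift by `2` only makes the radius positive.
  refine ⟨y 1 - y 0 + 2, by linarith [h0.2, h1.1],
    ⟨Or.inr ⟨(y 0, y 2), ⟨hy 0, hy 2⟩, ?_⟩, Or.inl ⟨(y 1, y 2), ⟨hy 1, hy 2⟩, ?_⟩⟩,
    Or.inr ⟨(y 1, y 0), ⟨hy 1, hy 0⟩, ?_⟩, Or.inl ⟨(y 1, y 0), ⟨hy 1, hy 0⟩, ?_⟩⟩ <;> ring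

theorem hasSideCoordinates_one_digitSet :
    HasSideCoordinates 1 (Icc 0 1)
      ((fun x => 2 * x + 2) '' digitSet 2 0 ∪ (fun x => 2 * x + -2) '' digitSet 2 1)
      ((fun x => 2 * x + 2) '' digitSet 2 0 ∪ (fun x => 2 * x + -2) '' digitSet 2 1) := by
  intro x hx
  obtain ⟨y, hy, hsum⟩ := exists_sum_digitSet (p := 2) two_pos hx
  obtain rfl : x = y 0 + y 1 := by rw [hsum, Finset.sum_range_succ, Finset.sum_range_one]
  have h0 := digitSet_subset_Icc _ _ (hy 0)
  have h1 := digitSet_subset_Icc _ _ (hy 1)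
  refine ⟨y 0 - y 1 + 2, by linarith [h0.1, h1.2],
    ⟨Or.inr ⟨y 1, hy 1, ?_⟩, Or.inl ⟨y 0, hy 0, ?_⟩⟩,
    Or.inr ⟨y 1, hy 1, ?_⟩, Or.inl ⟨y 0, hy 0, ?_⟩⟩ <;> ring

theorem minMinkowskiDim_segment_zero_le {a b : ℝ} (hab : a < b) :
    minMinkowskiDim (segment ℝ ![a, 0 * a] ![b, 0 * b]) ≤ ((5 / 3 : ℝ) : EReal) := by
  have hD (i : ℕ) := hasCoveringExponent_digitSet (p := 3) three_pos i
  have hX := ((hD 1).image_linear_combination (hD 2) 2 1 2).union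
    ((hD 0).image_linear_combination (hD 2) 2 1 (-2))
  have hY := ((hD 1).image_linear_combination (hD 0) 1 (-1) 2).union
    ((hD 1).image_linear_combination (hD 0) (-1) 1 (-2))
  exact (hasSideCoordinates_zero_digitSet.minMinkowskiDim_le one_pos hX hY hab).trans_eq
    (by norm_num)

theorem minMinkowskiDim_segment_one_le {a b : ℝ} (hab : a < b) :
    minMinkowskiDim (segment ℝ ![a, 1 * a] ![b, 1 * b]) ≤ ((3 / 2 : ℝ) : EReal) := by
  have hD (i : ℕ) := hasCoveringExponent_digitSet (p := 2) two_pos i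
  have hX := ((hD 0).image_mul_add 2 2).union ((hD 1).image_mul_add 2 (-2))
  exact (hasSideCoordinates_one_digitSet.minMinkowskiDim_le one_pos hX hX hab).trans_eq
    (by norm_num)

end UpperBounds

theorem mainTheorem11 :
    (∃ h : ℝ, 17 / 11 ≤ h ∧ h ≤ 7 / 4 ∧ ∀ a b : ℝ, a < b →
      minMinkowskiDim (segment ℝ ![a, 0] ![b, 0]) = (h : EReal) ∧
      minPackingDim (segment ℝ ![a, 0] ![b, 0]) = (h : EReal)) ∧
    (∀ a b : ℝ, a < b →
      minMinkowskiDim (segment ℝ ![a, a] ![b, b]) = ((3 / 2 : ℝ) : EReal) ∧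
      minPackingDim (segment ℝ ![a, a] ![b, b]) = ((3 / 2 : ℝ) : EReal)) := by
  constructor
  · have heq {a b a' b' : ℝ} (hab : a < b) (hab' : a' < b') :=
      minMinkowskiDim_segment_eq_minPackingDim_segment hab hab' 0
    have hlow := seventeen_div_eleven_le_minPackingDim_segment_zero zero_lt_one
    have hup := (heq zero_lt_one zero_lt_one).symm.trans_le
      (minMinkowskiDim_segment_zero_le zero_lt_one)
    simp only [zero_mul] at heq hlow hup
    obtain ⟨h, hh⟩ : ∃ h : ℝ, minPackingDim (segment ℝ ![0, 0] ![1, 0]) = h :=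
      ⟨_, (EReal.coe_toReal (ne_top_of_le_ne_top (EReal.coe_ne_top _) hup)
        (ne_bot_of_le_ne_bot (EReal.coe_ne_bot _) hlow)).symm⟩
    rw [hh, EReal.coe_le_coe_iff] at hlow hup
    exact ⟨h, hlow, hup.trans (by norm_num), fun a b hab => ⟨(heq hab zero_lt_one).trans hh,
      (heq zero_lt_one hab).symm.trans ((heq zero_lt_one zero_lt_one).trans hh)⟩⟩
  · intro a b hab
    have heq := minMinkowskiDim_segment_eq_minPackingDim_segment hab hab 1
    have hlow := three_halves_le_minPackingDim_segment hab 1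
    have hup := minMinkowskiDim_segment_one_le hab
    simp only [one_mul] at heq hlow hup
    exact ⟨hup.antisymm (heq ▸ hlow), (heq ▸ hup).antisymm hlow⟩
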